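/- Let $\mathbb F_1$ be a nonabelian free group with a fixed finite basis $\mathcal B_1$. For a group $G$ and $x\in[G,G]$, the genus of $x$ is the smallest $g\ge 0$ such that there is a homomorphism from the free group $\langle a_1,b_1,\dots,a_g,b_g\rangle$ to $G$ sending $[a_1,b_1]\cdots[a_g,b_g]$ to $x$. For a homomorphism $\phi:\mathbb F_1\to\mathbb F_2$ to a nonabelian free group with a fixed finite basis $\mathcal B_2$, identify elements of $\mathbb F_2$ with reduced $\mathcal B_2$-words and put $m(\phi)=\min\{|\phi(u)| : u\in\mathcal B_1\}$. For $\alpha>0$, $\phi$ is an $\alpha$-map if (i) for every $u\in\mathcal B_1$, every (possibly empty) subword of $\phi(u)$ of length $\ge\alpha m(\phi)$ occurs exactly once as a subword of $\phi(u)$, and (ii) whenever $u,v\in\mathcal B_1^{\pm1}$ and $\phi(u)$, $\phi(v)$ have a common (possibly empty) subword of length $\ge\alpha m(\phi)$, then $u=v$. Let $x\in\mathbb F_1$ have genus $g$. Then there is $\alpha>0$, depending only on $x$, such that for every nonabelian free group $\mathbb F_2$ with a finite basis and every $\alpha$-map $\phi:\mathbb F_1\to\mathbb F_2$, the element $\phi(x)$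 has genus $g$. Explicitly, if $M$ is the cyclic length of $x$ (the length of the cyclically reduced words conjugate to $x$), every $\alpha>0$ with $\alpha\cdot 4M(48g-24+M)<1$ has this property; that is, $0<\alpha<[4M(48g-24+M)]^{-1}$ if $x\ne 1$, and any $\alpha>0$ if $x=1$. -/

import Mathlib

universe u v

open scoped commutatorElement

namespace AlphaMap

/-- The boundary word `∂_g = [a₁, b₁] ⋯ [a_g, b_g]` in the free group
`H_g = ⟨a₁, b₁, …, a_g, b_g⟩` of rank `2g`; `a_i` is `Sum.inl i` and `b_i` is `Sum.inr i`. -/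
def boundaryWord (g : ℕ) : FreeGroup (Fin g ⊕ Fin g) :=
  (List.ofFn fun i : Fin g =>
    ⁅FreeGroup.of (Sum.inl i : Fin g ⊕ Fin g), FreeGroup.of (Sum.inr i : Fin g ⊕ Fin g)⁆).prod

/-- A genus `g` representation of `x` is a homomorphism `h : H_g → F` with `h ∂_g = x`. -/
def IsGenusRep {F : Type*} [Group F] (x : F) (g : ℕ)
    (h : FreeGroup (Fin g ⊕ Fin g) →* F) : Prop :=
  h (boundaryWord g) = x

/-- `x` has genus `g`: `g` is the smallest natural number for which `x` has a genus `g`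
representation. (Elements outside the commutator subgroup have no genus.) -/
def HasGenus {F : Type*} [Group F] (x : F) (g : ℕ) : Prop :=
  IsLeast {k : ℕ | ∃ h : FreeGroup (Fin k ⊕ Fin k) →* F, IsGenusRep x k h} g

/-- The length of the cyclically reduced cyclic word representing the conjugacy class of `x`. -/
def cyclicLength {B : Type*} [DecidableEq B] (x : FreeGroup B) : ℕ :=
  (FreeGroup.reduceCyclically x.toWord).length

section

variable {B₁ B₂ : Type*} [DecidableEq B₂]

/-- The reduced `B₂`-word representing `φ u`, for a letter `u ∈ B₁^{±1}`; the letter `(b, true)`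
is `b` and `(b, false)` is its inverse. -/
def letterWord (φ : FreeGroup B₁ →* FreeGroup B₂) (u : B₁ × Bool) : List (B₂ × Bool) :=
  (φ (FreeGroup.mk [u])).toWord

/-- `m(φ)`, the minimal length of `φ u` over the basis elements `u ∈ B₁`. -/
noncomputable def minLength (φ : FreeGroup B₁ →* FreeGroup B₂) : ℕ :=
  ⨅ u : B₁, (φ (FreeGroup.of u)).norm

/-- `φ` is an `α`-map. An occurrence of a (possibly empty) subword `w` in a word is a
decomposition `p ++ w ++ q` of that word. -/
structure IsAlphaMap (α : ℝ) (φ : FreeGroup B₁ →* FreeGroup B₂) : Prop where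
  /-- A long subword of `φ u` occurs only once in `φ u`. -/
  occurs_once : ∀ (u : B₁) (w p q p' q' : List (B₂ × Bool)),
    α * minLength φ ≤ w.length →
    letterWord φ (u, true) = p ++ w ++ q → letterWord φ (u, true) = p' ++ w ++ q' →
    p = p' ∧ q = q'
  /-- Images of distinct letters of `B₁^{±1}` share no long subword. -/
  eq_of_shared : ∀ (u v : B₁ × Bool) (w : List (B₂ × Bool)),
    α * minLength φ ≤ w.length → w <:+: letterWord φ u → w <:+: letterWord φ v → u = v

end

end AlphaMap

/-! A homomorphism cannot raise genus, so it must be shown that if `φ x` is a product of `k < g`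
commutators, then so is `x`. Up to conjugacy `x` is a cyclically reduced word `x₀` of length `M`,
and `φ x₀` is spelled by the concatenation, in general unreduced, of the blocks `φ(x₀ᵢ)`.

Being a product of `k` commutators is witnessed by a quadratic word `V` that is itself such a
product and carries the given word as labels. `HasLift.congr` shows that such a lift exists for
every spelling once it exists for one, so the concatenation of blocks has a lift. View `V` as a
polygon whose sides are glued in pairs by `τ`; then the cycles of `π`, which is `τ` followed by
rotation, are the vertices of a surface with one face. An Euler characteristic bound
(`card_letters_le_card_orbits`) leaves at most `12k + 3M` corners at vertices of valence at least 3,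
because corners of valence 1 occur only at block boundaries.

Away from at most `12k + 5M` cuts, `τ` reverses whole runs of letters. If such a run has length `d =
⌈α m(φ)⌉`, the α-map property forces it to match mirrored places in the blocks of a letter and of
its inverse (`IsGood.exists_partner`). Since `(12k + 5M + 1)(d - 1) < m(φ)`, each basis letter has a
place that starts a good run in all of its occurrences (`exists_good_place`). One position per
block, chosen in this way, gives a set closed under `τ`. Killing all other letters of `V` turns it
into `x₀`, still a product of `k` commutators. -/

namespace AlphaMap

/-! ### Products of commutators and signed letters -/

/-- `y` is a product of `k` commutators. -/
def IsCommProd {G : Type*} [Group G] (k : ℕ) (y : G) : Prop :=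
  ∃ a b : Fin k → G, (List.ofFn fun i => ⁅a i, b i⁆).prod = y

theorem isCommProd_iff_exists_isGenusRep {G : Type*} [Group G] {k : ℕ} {y : G} :
    IsCommProd k y ↔ ∃ h : FreeGroup (Fin k ⊕ Fin k) →* G, IsGenusRep y k h := by
  constructor
  · rintro ⟨a, b, h⟩
    refine ⟨FreeGroup.lift (Sum.elim a b), ?_⟩
    rw [IsGenusRep, boundaryWord, map_list_prod, List.map_ofFn, ← h]
    congr 2
    funext i
    simp [map_commutatorElement]
  · rintro ⟨h, hh⟩
    refine ⟨fun i => h (FreeGroup.of (Sum.inl i)), fun i => h (FreeGroup.of (Sum.inr i)), ?_⟩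
    rw [← hh, boundaryWord, map_list_prod, List.map_ofFn]
    congr 2
    funext i
    simp [map_commutatorElement]

theorem IsCommProd.map {G H : Type*} [Group G] [Group H] {k : ℕ} {y : G} (h : IsCommProd k y)
    (θ : G →* H) : IsCommProd k (θ y) := by
  obtain ⟨a, b, rfl⟩ := h
  refine ⟨θ ∘ a, θ ∘ b, ?_⟩
  rw [map_list_prod, List.map_ofFn]
  congr 2
  funext i
  simp [map_commutatorElement]

/-- The inverse of a letter. -/
def invLetter {C : Type*} (a : C × Bool) : C × Bool := (a.1, !a.2)

@[simp] theorem invLetter_invLetter {C : Type*} (a : C × Bool) : invLetter (invLetter a) = a := by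
  simp [invLetter]

theorem invLetter_ne {C : Type*} (a : C × Bool) : invLetter a ≠ a := by
  rcases a with ⟨c, _ | _⟩ <;> simp [invLetter]

theorem invLetter_injective {C : Type*} : Function.Injective (invLetter (C := C)) :=
  Function.LeftInverse.injective invLetter_invLetter

theorem invRev_eq_map_reverse {C : Type*} (l : List (C × Bool)) :
    FreeGroup.invRev l = (l.map invLetter).reverse := rfl

theorem mk_invLetter {C : Type*} (a : C × Bool) :
    FreeGroup.mk [invLetter a] = (FreeGroup.mk [a])⁻¹ := by
  simp [FreeGroup.inv_mk, FreeGroup.invRev, invLetter]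

theorem eq_or_eq_invLetter {C : Type*} {a b : C × Bool} (h : a.1 = b.1) :
    a = b ∨ a = invLetter b := by
  rcases a with ⟨a, _ | _⟩ <;> rcases b with ⟨b, _ | _⟩ <;> subst h <;> simp [invLetter]

/-! ### Quadratic lifts of words -/

/-- A quadratic word: every letter occurs at most once, and together with its inverse. -/
structure IsQuadratic {C : Type*} (V : List (C × Bool)) : Prop where
  nodup : V.Nodup
  inv_mem : ∀ a ∈ V, invLetter a ∈ V

/-- The word `L` is a relabelling of a quadratic word that is a product of `k` commutators in the
free group on its own letters. -/
def HasLift {β : Type*} (k : ℕ) (L : List (β × Bool)) : Prop :=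
  ∃ V : List ((β × ℕ) × Bool), IsQuadratic V ∧ IsCommProd k (FreeGroup.mk V) ∧
    V.map (Prod.map Prod.fst id) = L

theorem mk_map_eq {C : Type*} (θ : FreeGroup C →* FreeGroup C) (ρ : C × Bool → C × Bool)
    (V : List (C × Bool)) (h : ∀ a ∈ V, θ (FreeGroup.mk [a]) = FreeGroup.mk [ρ a]) :
    θ (FreeGroup.mk V) = FreeGroup.mk (V.map ρ) := by
  induction V with
  | nil => simp [← FreeGroup.one_eq_mk]
  | cons a V ih =>
    rw [← List.singleton_append, ← FreeGroup.mul_mk, map_mul, h a (by simp),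
      ih fun b hb => h b (by simp [hb]), FreeGroup.mul_mk]
    simp

/-- Identifying the letter `b` with the inverse of the letter `a`. -/
def glue {C : Type*} [DecidableEq C] (a b : C × Bool) : FreeGroup C →* FreeGroup C :=
  FreeGroup.lift fun c => if c = b.1 then FreeGroup.mk [(a.1, a.2 == !b.2)] else FreeGroup.of c

theorem glue_of_ne {C : Type*} [DecidableEq C] {a b d : C × Bool} (h : d.1 ≠ b.1) :
    glue a b (FreeGroup.mk [d]) = FreeGroup.mk [d] := by
  rcases d with ⟨d, _ | _⟩ <;> simp_all [glue, FreeGroup.lift_mk, FreeGroup.of, FreeGroup.inv_mk,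
    FreeGroup.invRev]

theorem glue_self {C : Type*} [DecidableEq C] {a b : C × Bool} :
    glue a b (FreeGroup.mk [b]) = FreeGroup.mk [invLetter a] := by
  rcases b with ⟨d, _ | _⟩ <;> rcases a with ⟨c, _ | _⟩ <;>
  simp [glue, FreeGroup.lift_mk, FreeGroup.of, FreeGroup.inv_mk, FreeGroup.invRev, invLetter]

theorem glue_invLetter {C : Type*} [DecidableEq C] {a b : C × Bool} :
    glue a b (FreeGroup.mk [invLetter b]) = FreeGroup.mk [a] := by
  rw [mk_invLetter, map_inv, glue_self, mk_invLetter, inv_inv]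

/-- A cancelling pair of labels lifts to adjacent letters `a`, `b`. If they are inverse in the lift
they cancel there; otherwise they have different names, and imposing `b = a⁻¹` is a homomorphism,
hence preserves commutator products, after which they cancel. -/
theorem HasLift.of_step {β : Type*} {k : ℕ} {L L' : List (β × Bool)}
    (hs : FreeGroup.Red.Step L L') (hL : HasLift k L) : HasLift k L' := by
  classical
  obtain ⟨V, hV, hk, hm⟩ := hL
  obtain @⟨X, Y, y, s⟩ := hs
  rw [List.map_eq_append_iff] at hm
  obtain ⟨X', V', rfl, rfl, hm⟩ := hm
  rw [List.map_eq_cons_iff] at hm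
  obtain ⟨a, V', rfl, ha, hm⟩ := hm
  rw [List.map_eq_cons_iff] at hm
  obtain ⟨b, Y', rfl, hb, rfl⟩ := hm
  have hmk : FreeGroup.mk (X' ++ a :: b :: Y') = FreeGroup.mk X' * FreeGroup.mk [a] *
      FreeGroup.mk [b] * FreeGroup.mk Y' := by simp [FreeGroup.mul_mk]
  obtain ⟨hnd, hinv⟩ := hV
  simp only [List.nodup_append, List.nodup_cons, List.mem_cons, not_or] at hnd
  obtain ⟨hX, ⟨⟨hab, haY⟩, hbY, hY⟩, hXY⟩ := hnd
  have haX : a ∉ X' := fun h => (hXY a h a (by simp)) rfl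
  have hbX : b ∉ X' := fun h => (hXY b h b (by simp)) rfl
  have hXYnd : (X' ++ Y').Nodup :=
    List.nodup_append.2 ⟨hX, hY, fun c hc d hd => hXY c hc d (by simp [hd])⟩
  have hmem : ∀ d, d ∈ X' ++ Y' ↔ d ∈ X' ++ a :: b :: Y' ∧ d ≠ a ∧ d ≠ b := by
    intro d
    simp only [List.mem_append, List.mem_cons]
    constructor
    · rintro (h | h)
      · exact ⟨.inl h, by rintro rfl; exact haX h, by rintro rfl; exact hbX h⟩
      · exact ⟨.inr (.inr (.inr h)), by rintro rfl; exact haY h, by rintro rfl; exact hbY h⟩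
    · tauto
  by_cases hc : b = invLetter a
  · subst hc
    refine ⟨X' ++ Y', ⟨hXYnd, fun d hd => ?_⟩, ?_, by simp⟩
    · rw [hmem] at hd ⊢
      refine ⟨hinv d hd.1, ?_, ?_⟩
      · intro h; exact hd.2.2 (by rw [← h, invLetter_invLetter])
      · intro h; exact hd.2.1 (invLetter_injective h)
    · have : FreeGroup.mk (X' ++ Y') = FreeGroup.mk (X' ++ a :: invLetter a :: Y') :=
        (Quot.sound FreeGroup.Red.Step.not).symm
      rwa [this]
  · have hab1 : a.1 ≠ b.1 := by
      intro h
      rcases eq_or_eq_invLetter h.symm with h | h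
      exacts [hab h.symm, hc h]
    -- After `a` and `b` are removed, only `b⁻¹` changes its name under the gluing: it becomes `a`,
    -- the new partner of `a⁻¹`.
    let ρ : (β × ℕ) × Bool → (β × ℕ) × Bool := fun d => if d = invLetter b then a else d
    have hρ : ∀ d ∈ X' ++ Y', glue a b (FreeGroup.mk [d]) = FreeGroup.mk [ρ d] := by
      intro d hd
      rw [hmem] at hd
      by_cases h : d = invLetter b
      · simp only [ρ, h, if_true, glue_invLetter]
      · simp only [ρ, h, if_false]
        apply glue_of_ne
        intro h1
        rcases eq_or_eq_invLetter h1 with h1 | h1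
        exacts [hd.2.2 h1, h h1]
    have hibm : invLetter b ∈ X' ++ Y' := by
      rw [hmem]
      exact ⟨hinv b (by simp), fun h => hc (by rw [← h, invLetter_invLetter]), invLetter_ne b⟩
    have hiam : invLetter a ∈ X' ++ Y' := by
      rw [hmem]
      exact ⟨hinv a (by simp), invLetter_ne a, fun h => hc h.symm⟩
    have hρa : ∀ d, d ≠ invLetter b → ρ d = d := fun d h => by simp [ρ, h]
    have hρb : ρ (invLetter b) = a := by simp [ρ]
    refine ⟨(X' ++ Y').map ρ, ⟨?_, ?_⟩, ?_, ?_⟩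
    · refine hXYnd.map_on ?_
      intro d hd e he hde
      by_cases h1 : d = invLetter b <;> by_cases h2 : e = invLetter b
      · rw [h1, h2]
      · rw [h1, hρb, hρa e h2] at hde
        exact absurd hde.symm ((hmem e).1 he).2.1
      · rw [h2, hρb, hρa d h1] at hde
        exact absurd hde ((hmem d).1 hd).2.1
      · rwa [hρa d h1, hρa e h2] at hde
    · intro d hd
      rw [List.mem_map] at hd ⊢
      obtain ⟨e, he, rfl⟩ := hd
      by_cases h1 : e = invLetter b
      · refine ⟨invLetter a, hiam, ?_⟩
        rw [h1, hρb, hρa]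
        exact fun h => hab (invLetter_injective h)
      · rw [hρa e h1]
        by_cases h2 : e = invLetter a
        · exact ⟨invLetter b, hibm, by rw [hρb, h2, invLetter_invLetter]⟩
        · have he' := (hmem e).1 he
          refine ⟨invLetter e, (hmem _).2 ⟨hinv e he'.1, ?_, ?_⟩, hρa _ ?_⟩
          · intro h; exact h2 (by rw [← h, invLetter_invLetter])
          · intro h; exact h1 (by rw [← h, invLetter_invLetter])
          · intro h; exact he'.2.2 (invLetter_injective h)
    · have := hk.map (glue a b)
      rw [hmk, map_mul, map_mul, map_mul, glue_of_ne hab1, glue_self, mk_invLetter,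
        mul_inv_cancel_right, ← map_mul, FreeGroup.mul_mk, mk_map_eq _ ρ _ hρ] at this
      exact this
    · rw [List.map_map, ← List.map_append]
      apply List.map_congr_left
      intro d hd
      by_cases h : d = invLetter b
      · subst h
        simp only [Function.comp, hρb]
        rw [ha]
        have : Prod.map Prod.fst id (invLetter b) = invLetter (Prod.map Prod.fst id b) := rfl
        rw [this, hb]
        simp [invLetter]
      · simp only [Function.comp, hρa d h]

theorem exists_fresh {β : Type*} (V : List ((β × ℕ) × Bool)) :
    ∃ n, ∀ a ∈ V, a.1.2 < n := by
  induction V with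
  | nil => exact ⟨0, by simp⟩
  | cons a V ih =>
    obtain ⟨n, hn⟩ := ih
    refine ⟨max n (a.1.2 + 1), ?_⟩
    intro b hb
    rcases List.mem_cons.1 hb with rfl | hb
    · omega
    · have := hn b hb; omega

/-- An inserted cancelling pair is lifted to a fresh letter and its inverse, which leaves the group
element unchanged. -/
theorem HasLift.of_step_symm {β : Type*} {k : ℕ} {L L' : List (β × Bool)}
    (hs : FreeGroup.Red.Step L L') (hL : HasLift k L') : HasLift k L := by
  obtain ⟨V, ⟨hnd, hinv⟩, hk, hm⟩ := hL
  obtain @⟨X, Y, y, s⟩ := hs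
  rw [List.map_eq_append_iff] at hm
  obtain ⟨X', Y', rfl, rfl, rfl⟩ := hm
  obtain ⟨n, hn⟩ := exists_fresh (X' ++ Y')
  have hf : ∀ s, ((y, n), s) ∉ X' ++ Y' := fun s h => lt_irrefl _ (hn _ h)
  have hperm : (X' ++ ((y, n), s) :: ((y, n), !s) :: Y').Perm
      (((y, n), s) :: ((y, n), !s) :: (X' ++ Y')) :=
    List.perm_middle.trans (List.Perm.cons _ List.perm_middle)
  refine ⟨X' ++ ((y, n), s) :: ((y, n), !s) :: Y', ⟨?_, ?_⟩, ?_, by simp⟩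
  · rw [hperm.nodup_iff]
    refine List.nodup_cons.2 ⟨?_, List.nodup_cons.2 ⟨hf _, hnd⟩⟩
    rw [List.mem_cons, not_or]
    exact ⟨by cases s <;> simp, hf _⟩
  · intro a ha
    rw [hperm.mem_iff, List.mem_cons, List.mem_cons] at ha ⊢
    rcases ha with rfl | rfl | ha
    · simp [invLetter]
    · simp [invLetter]
    · exact .inr (.inr (hinv a ha))
  · rwa [show FreeGroup.mk (X' ++ ((y, n), s) :: ((y, n), !s) :: Y') = FreeGroup.mk (X' ++ Y') from
      Quot.sound FreeGroup.Red.Step.not]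

theorem HasLift.congr {β : Type*} {k : ℕ} {L L' : List (β × Bool)}
    (h : FreeGroup.mk L = FreeGroup.mk L') : HasLift k L ↔ HasLift k L' := by
  have := Quot.eqvGen_exact h
  clear h
  induction this with
  | rel _ _ h => exact ⟨HasLift.of_step h, HasLift.of_step_symm h⟩
  | refl => rfl
  | symm _ _ _ ih => exact ih.symm
  | trans _ _ _ _ _ ih1 ih2 => exact ih1.trans ih2

/-- A word all of whose letters have different names, all above a given bound. -/
theorem exists_fresh_lift {β : Type*} (L : List (β × Bool)) (n : ℕ) :
    ∃ V : List ((β × ℕ) × Bool), (V.map Prod.fst).Nodup ∧ (∀ a ∈ V, n ≤ a.1.2) ∧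
      V.map (Prod.map Prod.fst id) = L := by
  induction L generalizing n with
  | nil => exact ⟨[], by simp⟩
  | cons a L ih =>
    obtain ⟨V, h1, h2, h3⟩ := ih (n + 1)
    refine ⟨((a.1, n), a.2) :: V, ?_, ?_, ?_⟩
    · rw [List.map_cons, List.nodup_cons]
      refine ⟨?_, h1⟩
      intro h
      obtain ⟨b, hb, hb'⟩ := List.mem_map.1 h
      have := h2 b hb
      rw [hb'] at this
      simp at this
    · intro b hb
      rcases List.mem_cons.1 hb with rfl | hb
      · simp
      · have := h2 b hb; omega
    · simp [h3]

/-- Spell each commutator as `A B A⁻¹ B⁻¹` and give every letter occurrence in `A` and `B` its own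
fresh name. -/
theorem exists_hasLift_of_isCommProd {β : Type*} {k : ℕ} {y : FreeGroup β} (h : IsCommProd k y) :
    ∃ L, FreeGroup.mk L = y ∧ HasLift k L := by
  obtain ⟨a, b, rfl⟩ := h
  induction k with
  | zero => exact ⟨[], by simp [FreeGroup.one_eq_mk], [], ⟨by simp, by simp⟩, ⟨Fin.elim0, Fin.elim0, by
      simp [FreeGroup.one_eq_mk]⟩, rfl⟩
  | succ k ih =>
    obtain ⟨L, hL, V, ⟨hnd, hinv⟩, ⟨a', b', hk⟩, rfl⟩ := ih (fun i => a i.succ) fun i => b i.succ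
    obtain ⟨n, hn⟩ := exists_fresh V
    obtain ⟨A, hA⟩ := Quot.exists_rep (a 0)
    obtain ⟨B, hB⟩ := Quot.exists_rep (b 0)
    change FreeGroup.mk A = a 0 at hA
    change FreeGroup.mk B = b 0 at hB
    obtain ⟨U, hU1, hU2, hU3⟩ := exists_fresh_lift (A ++ B) n
    obtain ⟨A', B', rfl, rfl, rfl⟩ := List.map_eq_append_iff.1 hU3
    have hnil : ∀ X : List ((β × ℕ) × Bool),
        (FreeGroup.invRev X).map (Prod.map Prod.fst id) =
          FreeGroup.invRev (X.map (Prod.map Prod.fst id)) := by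
      intro X; simp [FreeGroup.invRev]
    have hmem : ∀ (X : List ((β × ℕ) × Bool)) d, d ∈ FreeGroup.invRev X ↔ invLetter d ∈ X := by
      intro X d
      rw [invRev_eq_map_reverse, List.mem_reverse, List.mem_map]
      exact ⟨by rintro ⟨e, he, rfl⟩; simpa, fun h => ⟨_, h, by simp⟩⟩
    refine ⟨(A' ++ B' ++ FreeGroup.invRev A' ++ FreeGroup.invRev B' ++ V).map
      (Prod.map Prod.fst id), ?_, A' ++ B' ++ FreeGroup.invRev A' ++ FreeGroup.invRev B' ++ V,
      ⟨?_, ?_⟩, ⟨Fin.cons (FreeGroup.mk A') a', Fin.cons (FreeGroup.mk B') b', ?_⟩, rfl⟩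
    · rw [List.ofFn_succ, List.prod_cons, ← hL]
      simp only [List.map_append, hnil, ← FreeGroup.mul_mk, ← hA, ← hB, ← FreeGroup.inv_mk,
        commutatorElement_def, mul_assoc]
    · have hUnd : (A' ++ B').Nodup := List.Nodup.of_map _ hU1
      have hperm : (A' ++ B' ++ FreeGroup.invRev A' ++ FreeGroup.invRev B' ++ V).Perm
          ((A' ++ B') ++ ((A' ++ B').map invLetter ++ V)) := by
        rw [List.append_assoc (A' ++ B'), List.append_assoc (A' ++ B')]
        refine List.Perm.append_left _ (List.Perm.append_right _ ?_)
        rw [List.map_append]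
        exact (List.reverse_perm _).append (List.reverse_perm _)
      rw [hperm.nodup_iff]
      refine List.nodup_append.2 ⟨hUnd, List.nodup_append.2 ⟨hUnd.map invLetter_injective, hnd, ?_⟩, ?_⟩
      · rintro _ hd e he rfl
        obtain ⟨d, hd', rfl⟩ := List.mem_map.1 hd
        exact absurd (hn _ he) (not_lt.2 (hU2 d hd'))
      · rintro d hd e he rfl
        rcases List.mem_append.1 he with he | he
        · obtain ⟨e, he, h⟩ := List.mem_map.1 he
          have := List.inj_on_of_nodup_map hU1 he hd (by rw [← h]; rfl)
          subst this
          exact invLetter_ne e h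
        · exact absurd (hn _ he) (not_lt.2 (hU2 d hd))
    · intro d hd
      simp only [List.mem_append, hmem, invLetter_invLetter] at hd ⊢
      have := hinv d
      tauto
    · rw [List.ofFn_succ, List.prod_cons]
      simp only [Fin.cons_zero, Fin.cons_succ, hk]
      simp only [← FreeGroup.mul_mk, ← FreeGroup.inv_mk, commutatorElement_def, mul_assoc]

/-! ### The Euler characteristic bound via the Heisenberg group -/

/-- The Heisenberg group over `ℚ`. -/
@[ext] structure Heis where
  x : ℚ
  y : ℚ
  z : ℚ

namespace Heis

instance : Mul Heis := ⟨fun a b => ⟨a.x + b.x, a.y + b.y, a.z + b.z + a.x * b.y⟩⟩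
instance : One Heis := ⟨⟨0, 0, 0⟩⟩
instance : Inv Heis := ⟨fun a => ⟨-a.x, -a.y, a.x * a.y - a.z⟩⟩

@[simp] theorem mul_x (a b : Heis) : (a * b).x = a.x + b.x := rfl
@[simp] theorem mul_y (a b : Heis) : (a * b).y = a.y + b.y := rfl
@[simp] theorem mul_z (a b : Heis) : (a * b).z = a.z + b.z + a.x * b.y := rfl
@[simp] theorem one_x : (1 : Heis).x = 0 := rfl
@[simp] theorem one_y : (1 : Heis).y = 0 := rfl
@[simp] theorem one_z : (1 : Heis).z = 0 := rfl
@[simp] theorem inv_x (a : Heis) : a⁻¹.x = -a.x := rfl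
@[simp] theorem inv_y (a : Heis) : a⁻¹.y = -a.y := rfl
@[simp] theorem inv_z (a : Heis) : a⁻¹.z = a.x * a.y - a.z := rfl

instance : Group Heis :=
  Group.ofLeftAxioms
    (fun a b c => by ext <;> simp only [mul_x, mul_y, mul_z] <;> ring)
    (fun a => by ext <;> simp)
    (fun a => by ext <;> simp)

theorem commutatorElement_eq_one {a b : Heis} (ha : a.x = 0) (hb : b.x = 0) : ⁅a, b⁆ = 1 := by
  rw [commutatorElement_eq_one_iff_mul_comm]
  ext <;> simp [ha, hb] <;> ring

end Heis

/-- The evaluation pairing of the free group on `C` with functions on `C`. -/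
noncomputable def expSum (C : Type*) : FreeGroup C →* Multiplicative (Module.Dual ℚ (C → ℚ)) :=
  FreeGroup.lift fun c => Multiplicative.ofAdd (LinearMap.proj c)

/-- The homomorphism to the Heisenberg group with the given values of the coordinates `x`, `y` on
the generators. -/
def toHeis {C : Type*} (f g : C → ℚ) : FreeGroup C →* Heis :=
  FreeGroup.lift fun c => ⟨f c, g c, 0⟩

theorem toHeis_x {C : Type*} (f g : C → ℚ) (w : FreeGroup C) :
    (toHeis f g w).x = (expSum C w).toAdd f := by
  induction w using FreeGroup.induction_on with
  | C1 => simp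
  | of c => simp [toHeis, expSum]
  | inv_of c h => simp [h]
  | mul a b ha hb => simp [ha, hb]

theorem toHeis_mk_of_notMem {C : Type*} (f g : C → ℚ) (V : List (C × Bool))
    (h : ∀ a ∈ V, g a.1 = 0) :
    (toHeis f g (FreeGroup.mk V)).y = 0 ∧ (toHeis f g (FreeGroup.mk V)).z = 0 := by
  induction V with
  | nil => simp [← FreeGroup.one_eq_mk]
  | cons a V ih =>
    obtain ⟨h1, h2⟩ := ih fun b hb => h b (by simp [hb])
    have ha := h a (by simp)
    rw [← List.singleton_append, ← FreeGroup.mul_mk, map_mul]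
    rcases a with ⟨c, _ | _⟩ <;> simp_all [toHeis, FreeGroup.lift_mk]

/-- Map to the Heisenberg group with `x = f` and `y` the indicator of the name of `c`. All `aᵢ`,
`bᵢ` land in the abelian subgroup `x = 0`, so the whole word dies, while its `z` coordinate is, up
to sign, the value of `f` on `Y`. -/
theorem expSum_between_eq_zero {C : Type*} {k : ℕ} {X Y Z : List (C × Bool)} {c : C × Bool}
    (hnd : (X ++ c :: (Y ++ invLetter c :: Z)).Nodup) {a b : Fin k → FreeGroup C}
    (hV : (List.ofFn fun i => ⁅a i, b i⁆).prod =
      FreeGroup.mk (X ++ c :: (Y ++ invLetter c :: Z)))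
    {f : C → ℚ} (ha : ∀ i, (expSum C (a i)).toAdd f = 0)
    (hb : ∀ i, (expSum C (b i)).toAdd f = 0) :
    (expSum C (FreeGroup.mk Y)).toAdd f = 0 := by
  classical
  let g : C → ℚ := fun d => if d = c.1 then 1 else 0
  have hg : ∀ d : C × Bool, d ≠ c → d ≠ invLetter c → g d.1 = 0 := by
    intro d h1 h2
    simp only [g, ite_eq_right_iff, one_ne_zero, imp_false]
    intro h
    rcases eq_or_eq_invLetter h with h | h
    exacts [h1 h, h2 h]
  simp only [List.nodup_append, List.nodup_cons, List.mem_append, List.mem_cons, not_or] at hnd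
  obtain ⟨-, ⟨⟨hcY, -, hcZ⟩, -, ⟨hcZ', -⟩, hY⟩, hX⟩ := hnd
  have h1 := toHeis_mk_of_notMem f g X fun d hd => hg d (hX d hd _ (by simp)) (hX d hd _ (by simp))
  have h2 := toHeis_mk_of_notMem f g Y fun d hd => hg d (by rintro rfl; exact hcY hd)
    (hY d hd _ (by simp))
  have h3 := toHeis_mk_of_notMem f g Z fun d hd => hg d (by rintro rfl; exact hcZ hd)
    (by rintro rfl; exact hcZ' hd)
  have h0 : toHeis f g (FreeGroup.mk (X ++ c :: (Y ++ invLetter c :: Z))) = 1 := by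
    rw [← hV, map_list_prod, List.map_ofFn]
    apply List.prod_eq_one
    intro y hy
    obtain ⟨i, rfl⟩ := (List.mem_ofFn' _ _).1 hy
    simp only [Function.comp, map_commutatorElement]
    exact Heis.commutatorElement_eq_one (by rw [toHeis_x, ha]) (by rw [toHeis_x, hb])
  have h4 : FreeGroup.mk (X ++ c :: (Y ++ invLetter c :: Z)) = FreeGroup.mk X * (FreeGroup.mk [c] *
      (FreeGroup.mk Y * ((FreeGroup.mk [c])⁻¹ * FreeGroup.mk Z))) := by
    rw [← mk_invLetter]; simp [FreeGroup.mul_mk]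
  rw [h4] at h0
  simp only [map_mul, map_inv] at h0
  have hx := congrArg Heis.x h0
  have hz := congrArg Heis.z h0
  rw [← toHeis_x f g]
  have hc : (toHeis f g (FreeGroup.mk [c])).y = 1 ∨ (toHeis f g (FreeGroup.mk [c])).y = -1 := by
    rcases c with ⟨c, _ | _⟩ <;> simp [toHeis, FreeGroup.lift_mk, g]
  simp only [Heis.mul_x, Heis.mul_y, Heis.mul_z, Heis.inv_x, Heis.inv_y, Heis.inv_z, Heis.one_x,
    Heis.one_z, h1, h2, h3] at hx hz
  rcases hc with hc | hc <;> rw [hc] at hz <;> linarith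

/-- The value of `f` on the prefix of length `n` of `V`. -/
noncomputable def prefixSum {C : Type*} (f : C → ℚ) (V : List (C × Bool)) (n : ℕ) : ℚ :=
  (expSum C (FreeGroup.mk (V.take n))).toAdd f

theorem prefixSum_succ {C : Type*} (f : C → ℚ) (V : List (C × Bool)) {n : ℕ} (h : n < V.length) :
    prefixSum f V (n + 1) = prefixSum f V n + (expSum C (FreeGroup.mk [V[n]])).toAdd f := by
  rw [prefixSum, List.take_add_one, List.getElem?_eq_getElem h, ← FreeGroup.mul_mk, map_mul]
  rfl

theorem prefixSum_length {C : Type*} (f : C → ℚ) {V : List (C × Bool)} {k : ℕ}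
    (h : IsCommProd k (FreeGroup.mk V)) : prefixSum f V V.length = 0 := by
  obtain ⟨a, b, h⟩ := h
  rw [prefixSum, List.take_length, ← h, map_list_prod, List.map_ofFn, List.prod_eq_one]
  · rfl
  intro y hy
  obtain ⟨i, rfl⟩ := (List.mem_ofFn' _ _).1 hy
  rw [Function.comp, map_commutatorElement]
  exact commutatorElement_eq_one_iff_mul_comm.2 (mul_comm _ _)

theorem prefixSum_eq_of_lt {C : Type*} {k : ℕ} {V : List (C × Bool)} (hnd : V.Nodup)
    {a b : Fin k → FreeGroup C} (hV : (List.ofFn fun i => ⁅a i, b i⁆).prod = FreeGroup.mk V)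
    {f : C → ℚ} (ha : ∀ i, (expSum C (a i)).toAdd f = 0)
    (hb : ∀ i, (expSum C (b i)).toAdd f = 0) {p q : ℕ} (hpq : p < q) (hq : q < V.length)
    (h : V[q] = invLetter V[p]) : prefixSum f V (p + 1) = prefixSum f V q := by
  have hV1 : V = V.take p ++ V[p] :: ((V.drop (p + 1)).take (q - (p + 1)) ++
      invLetter V[p] :: V.drop (q + 1)) := by
    rw [← h]
    conv_lhs => rw [← List.take_append_drop p V]
    congr 1
    rw [List.drop_eq_getElem_cons (by omega)]
    congr 1
    conv_lhs => rw [← List.take_append_drop (q - (p + 1)) (V.drop (p + 1))]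
    congr 1
    rw [List.drop_drop, show p + 1 + (q - (p + 1)) = q by omega, List.drop_eq_getElem_cons hq]
  have h0 := expSum_between_eq_zero (hV1 ▸ hnd) (by rw [← hV1]; exact hV) ha hb
  have h1 : V.take q = V.take (p + 1) ++ (V.drop (p + 1)).take (q - (p + 1)) := by
    rw [← List.take_add]
    congr 1
    omega
  rw [prefixSum, prefixSum, h1, ← FreeGroup.mul_mk, map_mul]
  change _ = (expSum C _).toAdd f + (expSum C _).toAdd f
  rw [h0, add_zero]

theorem prefixSum_eq_prefixSum_succ {C : Type*} {k : ℕ} {V : List (C × Bool)} (hnd : V.Nodup)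
    {a b : Fin k → FreeGroup C} (hV : (List.ofFn fun i => ⁅a i, b i⁆).prod = FreeGroup.mk V)
    {f : C → ℚ} (ha : ∀ i, (expSum C (a i)).toAdd f = 0)
    (hb : ∀ i, (expSum C (b i)).toAdd f = 0) {p q : ℕ} (hp : p < V.length) (hq : q < V.length)
    (h : V[q] = invLetter V[p]) : prefixSum f V p = prefixSum f V (q + 1) := by
  rcases lt_trichotomy p q with hpq | rfl | hpq
  · have h1 := prefixSum_eq_of_lt hnd hV ha hb hpq hq h
    rw [prefixSum_succ f V hp] at h1
    rw [prefixSum_succ f V hq, h, mk_invLetter, map_inv, ← h1]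
    simp
  · exact absurd h.symm (invLetter_ne _)
  · exact (prefixSum_eq_of_lt hnd hV ha hb hpq hp (by rw [h, invLetter_invLetter])).symm

theorem IsQuadratic.exists_perm {C : Type*} {V : List (C × Bool)} (h : IsQuadratic V) :
    ∃ τ : Equiv.Perm (Fin V.length), ∀ p, V[τ p] = invLetter V[p] := by
  have : ∀ p : Fin V.length, ∃ q : Fin V.length, V[q] = invLetter V[p] := by
    intro p
    obtain ⟨q, hq, h⟩ := List.mem_iff_getElem.1 (h.inv_mem V[p] (List.getElem_mem _))
    exact ⟨⟨q, hq⟩, h⟩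
  choose τ hτ using this
  have hinv : Function.Involutive τ := by
    intro p
    have : V[τ (τ p)] = V[p] := by rw [hτ, hτ, invLetter_invLetter]
    exact Fin.ext ((h.nodup.getElem_inj_iff).1 this)
  exact ⟨hinv.toPerm, hτ⟩

theorem IsQuadratic.length_eq {C : Type*} [DecidableEq C] {V : List (C × Bool)}
    (h : IsQuadratic V) : V.length = 2 * (V.map Prod.fst).toFinset.card := by
  rw [← List.toFinset_card_of_nodup h.nodup]
  have : V.toFinset = (V.map Prod.fst).toFinset ×ˢ (Finset.univ : Finset Bool) := by
    ext ⟨c, s⟩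
    simp only [List.mem_toFinset, Finset.mem_product, List.mem_map, Finset.mem_univ, and_true]
    constructor
    · exact fun hc => ⟨_, hc, rfl⟩
    · rintro ⟨a, ha, rfl⟩
      rcases eq_or_eq_invLetter (a := (a.1, s)) (b := a) rfl with h1 | h1
      · rwa [h1]
      · rw [h1]; exact h.inv_mem a ha
  rw [this, Finset.card_product, mul_comm]
  rfl

/-- Give weight 6 to fixed points, 3 to points of 2-cycles and 2 to all others: every cycle then has
total weight at least 6. -/
theorem card_orbits_le {α : Type*} [Fintype α] [DecidableEq α] (π : Equiv.Perm α)
    [Fintype (Quotient (Equiv.Perm.SameCycle.setoid π))] :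
    6 * Fintype.card (Quotient (Equiv.Perm.SameCycle.setoid π)) +
      (Finset.univ.filter fun p => π p ≠ p ∧ π (π p) ≠ p).card ≤
    3 * Fintype.card α + 3 * (Finset.univ.filter fun p => π p = p).card := by
  classical
  let wt : α → ℕ := fun p => if π p = p then 6 else if π (π p) = p then 3 else 2
  have h1 : ∑ p, wt p + (Finset.univ.filter fun p => π p ≠ p ∧ π (π p) ≠ p).card =
      3 * Fintype.card α + 3 * (Finset.univ.filter fun p => π p = p).card := by
    rw [Finset.card_filter, Finset.card_filter, ← Finset.sum_add_distrib, Finset.mul_sum,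
      ← Finset.card_univ, Finset.card_eq_sum_ones, Finset.mul_sum, ← Finset.sum_add_distrib]
    refine Finset.sum_congr rfl fun p _ => ?_
    simp only [wt]
    split_ifs <;> simp_all
  rw [← h1]
  gcongr
  rw [← Finset.sum_fiberwise Finset.univ (fun p => (Quotient.mk (Equiv.Perm.SameCycle.setoid π) p)),
    mul_comm, ← smul_eq_mul, ← Finset.card_univ]
  refine Finset.card_nsmul_le_sum _ _ _ fun q _ => ?_
  induction q using Quotient.inductionOn with | _ p =>
  have hmem : ∀ q, π.SameCycle p q →
      q ∈ Finset.univ.filter fun r => (Quotient.mk (Equiv.Perm.SameCycle.setoid π) r) =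
        Quotient.mk (Equiv.Perm.SameCycle.setoid π) p := by
    intro q hq
    simp only [Finset.mem_filter, Finset.mem_univ, true_and]
    exact Quotient.sound hq.symm
  have m0 := hmem p (.refl _ _)
  have m1 := hmem (π p) (Equiv.Perm.sameCycle_apply_right.2 (.refl _ _))
  have m2 := hmem (π (π p)) 
    (Equiv.Perm.sameCycle_apply_right.2 (Equiv.Perm.sameCycle_apply_right.2 (.refl _ _)))
  by_cases hf : π p = p
  · refine le_trans ?_ (Finset.single_le_sum (fun _ _ => Nat.zero_le _) m0)
    simp [wt, hf]
  by_cases hff : π (π p) = p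
  · refine le_trans ?_ (Finset.sum_le_sum_of_subset (s := {p, π p}) ?_)
    · rw [Finset.sum_pair (Ne.symm hf)]
      simp [wt, hf, hff, Ne.symm hf]
    · intro r hr
      simp only [Finset.mem_insert, Finset.mem_singleton] at hr
      rcases hr with rfl | rfl <;> assumption
  · refine le_trans ?_ (Finset.sum_le_sum_of_subset (s := {p, π p, π (π p)}) ?_)
    · rw [Finset.sum_insert, Finset.sum_pair]
      · simp [wt, hf, hff]
      · simpa using Ne.symm hf
      · simp [Ne.symm hf, Ne.symm hff]
    · intro r hr
      simp only [Finset.mem_insert, Finset.mem_singleton] at hr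
      rcases hr with rfl | rfl | rfl <;> assumption

theorem val_finRotate {N : ℕ} (q : Fin N) :
    (finRotate N q : ℕ) = if (q : ℕ) + 1 = N then 0 else (q : ℕ) + 1 := by
  cases N with
  | zero => exact q.elim0
  | succ N =>
    rw [coe_finRotate]
    simp [Fin.ext_iff]

/-- This is the Euler bound "edges ≤ vertices + 2k" by linear algebra. Functions on the letters that
vanish on all `aᵢ`, `bᵢ` have codimension at most `2k`; their prefix sums are constant on the cycles
of `π` and determine the function. -/
theorem card_letters_le_card_orbits {C : Type*} [DecidableEq C] {k : ℕ} {V : List (C × Bool)}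
    (hq : IsQuadratic V) (hV : IsCommProd k (FreeGroup.mk V)) {τ π : Equiv.Perm (Fin V.length)}
    (hτ : ∀ p, V[τ p] = invLetter V[p]) (hπ : π = τ.trans (finRotate V.length))
    [Fintype (Quotient (Equiv.Perm.SameCycle.setoid π))] :
    (V.map Prod.fst).toFinset.card ≤
      Fintype.card (Quotient (Equiv.Perm.SameCycle.setoid π)) + 2 * k := by
  set S := (V.map Prod.fst).toFinset with hS
  have hV' := hV
  obtain ⟨a, b, hab⟩ := hV
  let E : (S → ℚ) →ₗ[ℚ] (C → ℚ) := Function.ExtendByZero.linearMap ℚ Subtype.val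
  let Λ : (S → ℚ) →ₗ[ℚ] (Fin k ⊕ Fin k → ℚ) :=
    LinearMap.pi fun j => (expSum C (Sum.elim a b j)).toAdd ∘ₗ E
  let Ψ : (S → ℚ) →ₗ[ℚ] (Fin V.length → ℚ) :=
    LinearMap.pi fun p => (expSum C (FreeGroup.mk (V.take p))).toAdd ∘ₗ E
  let R : (Quotient (Equiv.Perm.SameCycle.setoid π) → ℚ) →ₗ[ℚ] (Fin V.length → ℚ) :=
    LinearMap.funLeft ℚ ℚ (Quotient.mk _)
  have hΨ : Function.Injective Ψ := by
    rw [← LinearMap.ker_eq_bot, LinearMap.ker_eq_bot']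
    intro f hf
    have hp : ∀ n ≤ V.length, prefixSum (E f) V n = 0 := by
      intro n hn
      rcases hn.lt_or_eq with h | rfl
      · exact congrFun hf ⟨n, h⟩
      · exact prefixSum_length _ hV'
    ext ⟨c, hc⟩
    obtain ⟨d, hd, rfl⟩ := List.mem_map.1 (List.mem_toFinset.1 hc)
    obtain ⟨n, hn, rfl⟩ := List.mem_iff_getElem.1 hd
    have h1 := prefixSum_succ (E f) V hn
    rw [hp _ hn, hp _ hn.le, zero_add] at h1
    have h2 : E f (V[n].1) = 0 := by
      generalize V[n] = d at h1
      rcases d with ⟨c, _ | _⟩ <;> simpa [expSum, FreeGroup.lift_mk] using h1.symm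
    exact (Subtype.val_injective.extend_apply f 0 (⟨_, hc⟩ : S)).symm.trans h2
  have hmap : (LinearMap.ker Λ).map Ψ ≤ LinearMap.range R := by
    rintro _ ⟨f, hf, rfl⟩
    have hf' : ∀ j, (expSum C (Sum.elim a b j)).toAdd (E f) = 0 := fun j => congrFun hf j
    have hstep : ∀ p, Ψ f (π p) = Ψ f p := by
      intro p
      have h1 := prefixSum_eq_prefixSum_succ hq.nodup hab (f := E f) (fun i => hf' (.inl i))
        (fun i => hf' (.inr i)) p.2 (τ p).2 (hτ p)
      change prefixSum (E f) V _ = prefixSum (E f) V _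
      rw [h1]
      simp only [hπ, Equiv.trans_apply]
      generalize τ p = q
      rw [val_finRotate]
      -- At the wrap-around the full sum agrees with the empty one, since exponent sums of
      -- commutators vanish.
      split_ifs with h
      · rw [h, prefixSum_length _ hV']
        simp [prefixSum, ← FreeGroup.one_eq_mk]
      · rfl
    refine ⟨Quotient.lift (Ψ f) ?_, ?_⟩
    · rintro p q ⟨i, rfl⟩
      have : ∀ (n : ℕ) p, Ψ f ((π ^ n) p) = Ψ f p := by
        intro n
        induction n with
        | zero => simp
        | succ n ih => intro p; rw [pow_succ, Equiv.Perm.mul_apply, ih, hstep]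
      obtain ⟨n, rfl | rfl⟩ := i.eq_nat_or_neg
      · simp [this]
      · conv_lhs => rw [show p = (π ^ n) ((π ^ (-(n : ℤ))) p) by simp]
        rw [this]
    · ext p; rfl
  have h1 := LinearMap.finrank_range_add_finrank_ker Λ
  have h2 := Submodule.finrank_le (LinearMap.range Λ)
  have h3 := (Submodule.equivMapOfInjective Ψ hΨ (LinearMap.ker Λ)).finrank_eq
  have h4 := Submodule.finrank_mono hmap
  have h5 := LinearMap.finrank_range_le R
  simp only [Module.finrank_fintype_fun_eq_card, Fintype.card_sum, Fintype.card_fin,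
    Fintype.card_coe] at h1 h2 h5
  omega

/-- All but few corners of a quadratic word that is a product of `k` commutators are 2-valent. -/
theorem card_corners_le {C : Type*} {k : ℕ} {V : List (C × Bool)}
    (hq : IsQuadratic V) (hV : IsCommProd k (FreeGroup.mk V)) {τ π : Equiv.Perm (Fin V.length)}
    (hτ : ∀ p, V[τ p] = invLetter V[p]) (hπ : π = τ.trans (finRotate V.length)) :
    (Finset.univ.filter fun p => π p ≠ p ∧ π (π p) ≠ p).card ≤
      12 * k + 3 * (Finset.univ.filter fun p => π p = p).card := by
  classical
  have h1 := card_orbits_le π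
  have h2 := card_letters_le_card_orbits hq hV hτ hπ
  have h3 := hq.length_eq
  rw [Fintype.card_fin] at h1
  omega

/-! ### Deleting letters from a quadratic word -/

theorem apply_apply_eq_self {C : Type*} {V : List (C × Bool)} (hnd : V.Nodup)
    {τ : Equiv.Perm (Fin V.length)} (hτ : ∀ p, V[τ p] = invLetter V[p]) (p : Fin V.length) :
    τ (τ p) = p := by
  have : V[τ (τ p)] = V[p] := by rw [hτ, hτ, invLetter_invLetter]
  exact Fin.ext ((hnd.getElem_inj_iff).1 this)

/-- Stated for prefixes to allow induction: `i` is the number of kept positions below `n`. -/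
theorem hom_mk_take_eq {C B G : Type*} [Group G] {x₀ : List (B × Bool)} {V : List (C × Bool)}
    {pos : Fin x₀.length → Fin V.length} (hpos : StrictMono pos) {θ : FreeGroup C →* G}
    {ψ : FreeGroup B →* G} (h1 : ∀ i, θ (FreeGroup.mk [V[pos i]]) = ψ (FreeGroup.mk [x₀[i]]))
    (h2 : ∀ p, (∀ i, pos i ≠ p) → θ (FreeGroup.mk [V[p]]) = 1) (n i : ℕ) (hn : n ≤ V.length)
    (hi : i ≤ x₀.length) (h : ∀ j : Fin x₀.length, (j : ℕ) < i ↔ (pos j : ℕ) < n) :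
    θ (FreeGroup.mk (V.take n)) = ψ (FreeGroup.mk (x₀.take i)) := by
  induction n generalizing i with
  | zero =>
    obtain rfl : i = 0 := by
      by_contra hi0
      exact absurd ((h ⟨0, by omega⟩).1 (Nat.pos_of_ne_zero hi0)) (Nat.not_lt_zero _)
    simp [← FreeGroup.one_eq_mk]
  | succ n ih =>
    rw [List.take_add_one, List.getElem?_eq_getElem (by omega), ← FreeGroup.mul_mk, map_mul]
    simp only [Option.toList_some]
    by_cases hj : ∃ j, (pos j : ℕ) = n
    · obtain ⟨j, hj⟩ := hj
      have hji : (j : ℕ) < i := (h j).2 (by omega)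
      obtain rfl : i = j + 1 := by
        by_contra hne
        have h3 := (h ⟨j + 1, by omega⟩).1 (by simp only; omega)
        have h4 : pos j < pos ⟨j + 1, by omega⟩ := hpos (Fin.lt_def.2 (by simp))
        rw [Fin.lt_def] at h4
        omega
      rw [ih j (by omega) (by omega), List.take_add_one (l := x₀),
        List.getElem?_eq_getElem j.2, ← FreeGroup.mul_mk, map_mul]
      · subst hj
        exact congrArg _ (h1 j)
      · intro j'
        rw [← hj, ← Fin.lt_def, ← Fin.lt_def, hpos.lt_iff_lt]
    · have h3 := h2 ⟨n, by omega⟩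
      simp only [Fin.getElem_fin] at h3
      rw [ih i (by omega) hi, h3, mul_one]
      · intro j hj'
        exact hj ⟨j, by rw [hj']⟩
      · intro j
        have : (pos j : ℕ) ≠ n := fun h => hj ⟨j, h⟩
        rw [h]
        omega

/-- Killing the letters of a quadratic word outside a set of positions closed under the pairing. -/
theorem isCommProd_of_positions {C B : Type*} {k : ℕ} {x₀ : List (B × Bool)} {V : List (C × Bool)}
    (hnd : V.Nodup) (hk : IsCommProd k (FreeGroup.mk V)) {τ : Equiv.Perm (Fin V.length)}
    (hτ : ∀ p, V[τ p] = invLetter V[p]) {pos : Fin x₀.length → Fin V.length}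
    (hpos : StrictMono pos)
    (hpair : ∀ i, ∃ j, τ (pos i) = pos j ∧ x₀[i] = invLetter x₀[j]) :
    IsCommProd k (FreeGroup.mk x₀) := by
  classical
  let θ : FreeGroup C →* FreeGroup B := FreeGroup.lift fun c =>
    if h : ∃ i, V[pos i] = (c, true) then FreeGroup.mk [x₀[h.choose]] else 1
  have hθ : ∀ c, θ (FreeGroup.mk [(c, true)]) =
      if h : ∃ i, V[pos i] = (c, true) then FreeGroup.mk [x₀[h.choose]] else 1 := by
    intro c; simp [θ, FreeGroup.lift_mk]
  have hVinj : ∀ p q : Fin V.length, V[p] = V[q] → p = q := fun p q h =>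
    Fin.ext ((hnd.getElem_inj_iff).1 h)
  have h1 : ∀ i c, V[pos i] = (c, true) → θ (FreeGroup.mk [V[pos i]]) = FreeGroup.mk [x₀[i]] := by
    intro i c hc
    have h : ∃ i, V[pos i] = (c, true) := ⟨i, hc⟩
    have hi := hpos.injective (hVinj _ _ (h.choose_spec.trans hc.symm))
    rw [hc, hθ, dif_pos h]
    simp only [hi]
  have h2 : ∀ p c, (∀ i, pos i ≠ p) → V[p] = (c, true) → θ (FreeGroup.mk [V[p]]) = 1 := by
    intro p c hp hc
    rw [hc, hθ, dif_neg]
    rintro ⟨i, hi⟩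
    exact hp i (hVinj _ _ (hi.trans hc.symm))
  have hττ := apply_apply_eq_self hnd hτ
  have hinv : ∀ p, θ (FreeGroup.mk [V[p]]) = (θ (FreeGroup.mk [V[τ p]]))⁻¹ := by
    intro p
    rw [hτ, mk_invLetter, map_inv, inv_inv]
  have hneg : ∀ p c, V[p] = (c, false) → V[τ p] = (c, true) := by
    intro p c h
    rw [hτ, h]; rfl
  have := hk.map θ
  rw [show FreeGroup.mk V = FreeGroup.mk (V.take V.length) by simp,
    hom_mk_take_eq hpos (ψ := MonoidHom.id _) ?_ ?_ V.length x₀.length le_rfl le_rfl (by simp)]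
    at this
  · simpa using this
  -- `θ` is prescribed on positive letters only; at a negative one the paired position determines
  -- the value.
  · intro i
    rcases h : V[pos i] with ⟨c, _ | _⟩
    · rw [← h, hinv]
      obtain ⟨j, hj, hx⟩ := hpair i
      have h' := hneg _ c h
      simp only [hj] at h' ⊢
      rw [h1 j c h', hx, mk_invLetter]
      rfl
    · rw [← h]; exact h1 i c h
  · intro p hp
    rcases h : V[p] with ⟨c, _ | _⟩
    · rw [← h, hinv, h2 _ c _ (hneg _ c h), inv_one]
      intro j hj
      obtain ⟨j', hj', -⟩ := hpair j
      exact hp j' (by rw [← hj', hj, hττ])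
    · rw [← h]; exact h2 p c hp h

/-! ### Block decomposition -/

/-- The position in `x₀.flatMap w` at which the block of the `i`-th letter of `x₀` starts. -/
def blockStart {A β : Type*} (w : A → List β) (x₀ : List A) (i : ℕ) : ℕ :=
  ((x₀.take i).flatMap w).length

section Blocks

variable {A β : Type*} (w : A → List β) (x₀ : List A)

theorem blockStart_zero : blockStart w x₀ 0 = 0 := by simp [blockStart]

theorem blockStart_length : blockStart w x₀ x₀.length = (x₀.flatMap w).length := by
  simp only [blockStart, List.take_length]

theorem blockStart_succ (i : Fin x₀.length) :
    blockStart w x₀ (i + 1) = blockStart w x₀ i + (w x₀[i]).length := by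
  rw [blockStart, List.take_add_one, List.getElem?_eq_getElem i.2, List.flatMap_append,
    List.length_append]
  simp [blockStart]

theorem blockStart_mono : Monotone (blockStart w x₀) := by
  intro i j h
  have : x₀.take j = x₀.take i ++ (x₀.drop i).take (j - i) := by
    rw [← List.take_add]; congr 1; omega
  rw [blockStart, blockStart, this, List.flatMap_append, List.length_append]
  omega

theorem exists_block {p : ℕ} (hp : p < (x₀.flatMap w).length) :
    ∃ (i : Fin x₀.length) (t : ℕ), t < (w x₀[i]).length ∧ p = blockStart w x₀ i + t := by
  rw [← blockStart_length] at hp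
  have : ∀ n ≤ x₀.length, p < blockStart w x₀ n →
      ∃ (i : Fin x₀.length) (t : ℕ), t < (w x₀[i]).length ∧ p = blockStart w x₀ i + t := by
    intro n hn
    induction n with
    | zero => intro h; rw [blockStart_zero] at h; omega
    | succ n ih =>
      intro h
      by_cases h' : p < blockStart w x₀ n
      · exact ih (by omega) h'
      · have := blockStart_succ w x₀ ⟨n, hn⟩
        simp only at this
        exact ⟨⟨n, hn⟩, p - blockStart w x₀ n, by omega, by simp only; omega⟩
  exact this _ le_rfl hp

theorem block_lt_block {i j : Fin x₀.length} (h : i < j) {s t : ℕ} (hs : s < (w x₀[i]).length) :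
    blockStart w x₀ i + s < blockStart w x₀ j + t := by
  have h1 := blockStart_succ w x₀ i
  have h2 := blockStart_mono w x₀ (Nat.succ_le_of_lt (Fin.lt_def.1 h))
  rw [Nat.succ_eq_add_one] at h2
  omega

theorem block_unique {i j : Fin x₀.length} {s t : ℕ} (hs : s < (w x₀[i]).length)
    (ht : t < (w x₀[j]).length) (h : blockStart w x₀ i + s = blockStart w x₀ j + t) :
    i = j ∧ s = t := by
  rcases lt_trichotomy i j with hij | rfl | hij
  · have := block_lt_block w x₀ hij (t := t) hs; omega
  · exact ⟨rfl, by omega⟩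
  · have := block_lt_block w x₀ hij (t := s) ht; omega

theorem block_lt_length (i : Fin x₀.length) {t : ℕ} (ht : t < (w x₀[i]).length) :
    blockStart w x₀ i + t < (x₀.flatMap w).length := by
  have h1 := blockStart_succ w x₀ i
  have h2 := blockStart_mono w x₀ (Nat.succ_le_of_lt i.2)
  rw [blockStart_length] at h2
  rw [Nat.succ_eq_add_one] at h2
  omega

theorem getElem?_block (i : Fin x₀.length) {t : ℕ} (ht : t < (w x₀[i]).length) :
    (x₀.flatMap w)[blockStart w x₀ i + t]? = (w x₀[i])[t]? := by
  have : x₀ = x₀.take i ++ x₀[i] :: x₀.drop (i + 1) := by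
    conv_lhs => rw [← List.take_append_drop i x₀, List.drop_eq_getElem_cons i.2]
    rfl
  conv_lhs => enter [1]; rw [this]
  rw [List.flatMap_append, List.flatMap_cons,
    List.getElem?_append_right (by simp only [blockStart]; omega)]
  rw [List.getElem?_append_left]
  · simp [blockStart]
  · simp only [blockStart]; omega

/-- A run leaving its block would meet the start of the next block or the end of the word. -/
theorem add_le_length_block {i : Fin x₀.length} {s d : ℕ} (hs : s < (w x₀[i]).length)
    (h : ∀ t, 1 ≤ t → t < d → blockStart w x₀ i + s + t < (x₀.flatMap w).length ∧
      ∀ j : Fin x₀.length, blockStart w x₀ i + s + t ≠ blockStart w x₀ j) :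
    s + d ≤ (w x₀[i]).length := by
  by_contra hd
  obtain ⟨h1, h2⟩ := h ((w x₀[i]).length - s) (by omega) (by omega)
  have h3 := blockStart_succ w x₀ i
  have h4 : blockStart w x₀ i + s + ((w x₀[i]).length - s) = blockStart w x₀ (i + 1) := by omega
  rw [h4] at h1 h2
  rcases Nat.lt_or_ge (i + 1) x₀.length with hi | hi
  · exact h2 ⟨i + 1, hi⟩ rfl
  · have := blockStart_mono w x₀ hi
    rw [blockStart_length] at this
    omega

end Blocks

/-! ### Rigid words -/

/-- Words assigned to the letters of `B^{±1}`, compatibly with inverses, that determine the letter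
and the position from each of their subwords of length at least `d`. -/
structure IsRigid {B β : Type*} (w : B × Bool → List (β × Bool)) (d : ℕ) : Prop where
  map_invLetter : ∀ u, w (invLetter u) = FreeGroup.invRev (w u)
  isReduced : ∀ u, FreeGroup.IsReduced (w u)
  occurs_once : ∀ u l p q p' q', d ≤ l.length → w u = p ++ l ++ q → w u = p' ++ l ++ q' → p = p'
  eq_of_shared : ∀ u v l, d ≤ l.length → l <:+: w u → l <:+: w v → u = v

/-- The run in `w u` is the inverse of a run in `w v`, hence a subword of `w (v⁻¹)`. Its length
identifies the letters, and uniqueness of its occurrence then identifies the places. -/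
theorem IsRigid.aligned {B β : Type*} {w : B × Bool → List (β × Bool)} {d : ℕ} (hw : IsRigid w d)
    {u v : B × Bool} {s t : ℕ} (hs : s + d ≤ (w u).length) (ht : t + d ≤ (w v).length)
    (h : ∀ r < d, (w u)[s + r]? = ((w v)[t + (d - 1 - r)]?).map invLetter) :
    u = invLetter v ∧ s + d + t = (w v).length := by
  have hsplit : ∀ (l : List (β × Bool)) (s : ℕ), l = l.take s ++ (l.drop s).take d ++
      l.drop (s + d) := by
    intro l s
    rw [List.append_assoc, ← List.drop_drop, List.take_append_drop, List.take_append_drop]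
  have hA : ((w u).drop s).take d = FreeGroup.invRev (((w v).drop t).take d) := by
    rw [invRev_eq_map_reverse]
    have hlen : (((w v).drop t).take d).length = d := by
      rw [List.length_take, List.length_drop]; omega
    apply List.ext_getElem?
    intro r
    by_cases hr : r < d
    · rw [List.getElem?_reverse (by rw [List.length_map, hlen]; exact hr), List.length_map, hlen,
        List.getElem?_map, List.getElem?_take_of_lt hr, List.getElem?_take_of_lt (by omega),
        List.getElem?_drop, List.getElem?_drop, h r hr]
    · rw [List.getElem?_eq_none, List.getElem?_eq_none]
      · rw [List.length_reverse, List.length_map, hlen]; omega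
      · rw [List.length_take]; omega
  have hu := hsplit (w u) s
  have hv : w (invLetter v) = FreeGroup.invRev ((w v).drop (t + d)) ++ ((w u).drop s).take d ++
      FreeGroup.invRev ((w v).take t) := by
    rw [hw.map_invLetter, hA]
    conv_lhs => rw [hsplit (w v) t]
    simp [FreeGroup.invRev]
  have hlen : d ≤ (((w u).drop s).take d).length := by
    rw [List.length_take, List.length_drop]; omega
  have huv := hw.eq_of_shared u (invLetter v) _ hlen ⟨_, _, hu.symm⟩ ⟨_, _, hv.symm⟩
  refine ⟨huv, ?_⟩
  rw [← huv] at hv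
  have := congrArg List.length (hw.occurs_once u _ _ _ _ _ hlen hu hv)
  rw [FreeGroup.invRev_length, List.length_take, List.length_drop] at this
  omega

/-! ### Cuts, good positions and the transfer of commutator products -/

section

variable {C B β : Type*} {w : B × Bool → List (β × Bool)} {x₀ : List (B × Bool)} {d k : ℕ}
  {V : List (C × Bool)} {τ π : Equiv.Perm (Fin V.length)}

variable (w x₀ V) in
/-- The position `p` is the start of a block. -/
def IsStart (p : Fin V.length) : Prop := ∃ i : Fin x₀.length, (p : ℕ) = blockStart w x₀ i

variable (w x₀ π) in
/-- The corner before `p` is a block boundary, is identified with one, or is not 2-valent. -/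
def IsCut (p : Fin V.length) : Prop :=
  IsStart w x₀ V p ∨ IsStart w x₀ V (π p) ∨ π p = p ∨ (π p ≠ p ∧ π (π p) ≠ p)

variable (w x₀ π d) in
/-- The subword of length `d` starting at `p` contains no cut. -/
def IsGood (p : Fin V.length) : Prop :=
  ∀ t, 1 ≤ t → t < d → ∃ q : Fin V.length, (q : ℕ) = p + t ∧ ¬ IsCut w x₀ π q

/-- At a 2-valent corner the two adjacent sides are glued to two adjacent sides in reverse order. -/
theorem pairing_of_not_isCut (hnd : V.Nodup) (hτ : ∀ p, V[τ p] = invLetter V[p])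
    (hπ : π = τ.trans (finRotate V.length)) (hlen : V.length = (x₀.flatMap w).length)
    {p q : Fin V.length} (hpq : (q : ℕ) = p + 1) (hq : ¬ IsCut w x₀ π q) :
    (τ q : ℕ) + 1 = τ p ∧ ¬ IsStart w x₀ V (τ p) := by
  simp only [IsCut, not_or, not_and, not_not] at hq
  obtain ⟨-, h2, h3, h4⟩ := hq
  have h4 := h4 h3
  -- Position 0 always starts a block, so corners away from block starts never involve the
  -- wrap-around of the rotation.
  have hstart : ∀ r : Fin V.length, ¬ IsStart w x₀ V r → (r : ℕ) ≠ 0 := by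
    intro r hr h0
    obtain ⟨i, -⟩ := exists_block w x₀ (p.2.trans_eq hlen)
    exact hr ⟨⟨0, i.pos⟩, by rw [h0, blockStart_zero]⟩
  have hval : ∀ r, (π r : ℕ) = if (τ r : ℕ) + 1 = V.length then 0 else (τ r : ℕ) + 1 := by
    intro r
    rw [hπ, Equiv.trans_apply, val_finRotate]
  have h5 := hstart _ h2
  have h6 : π q = τ p := by
    have h7 := hval (π q)
    rw [h4] at h7
    have h8 : τ (π q) = p := by
      split_ifs at h7 with h9
      · omega
      · exact Fin.ext (by omega)
    rw [← h8, apply_apply_eq_self hnd hτ]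
  refine ⟨?_, h6 ▸ h2⟩
  rw [← h6, hval]
  rw [hval] at h5
  split_ifs at h5 ⊢ <;> omega

theorem IsGood.pairing (hnd : V.Nodup) (hτ : ∀ p, V[τ p] = invLetter V[p])
    (hπ : π = τ.trans (finRotate V.length)) (hlen : V.length = (x₀.flatMap w).length)
    {p : Fin V.length} (hp : IsGood w x₀ d π p) (t : ℕ) (ht : t < d) :
    ∃ q : Fin V.length, (q : ℕ) = p + t ∧ (τ q : ℕ) + t = τ p ∧ (1 ≤ t → ¬ IsStart w x₀ V q) ∧
      (t + 1 < d → ¬ IsStart w x₀ V (τ q)) := by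
  induction t with
  | zero =>
    refine ⟨p, rfl, rfl, by simp, fun h => ?_⟩
    obtain ⟨r, hr, hc⟩ := hp 1 le_rfl h
    exact (pairing_of_not_isCut hnd hτ hπ hlen hr hc).2
  | succ t ih =>
    obtain ⟨q, hq, hτq, -⟩ := ih (by omega)
    obtain ⟨r, hr, hc⟩ := hp (t + 1) (by omega) ht
    have h1 := pairing_of_not_isCut hnd hτ hπ hlen (p := q) (by omega) hc
    refine ⟨r, hr, by omega, fun _ h => hc (.inl h), fun h => ?_⟩
    obtain ⟨r', hr', hc'⟩ := hp (t + 1 + 1) (by omega) h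
    exact (pairing_of_not_isCut hnd hτ hπ hlen (p := r) (by omega) hc').2

theorem IsGood.exists_partner (hw : IsRigid w d) (hd : 1 ≤ d) (hnd : V.Nodup)
    (hτ : ∀ p, V[τ p] = invLetter V[p])
    (hπ : π = τ.trans (finRotate V.length)) {lab : C → β}
    (hlab : V.map (Prod.map lab id) = x₀.flatMap w)
    {p : Fin V.length} (hp : IsGood w x₀ d π p) {i : Fin x₀.length} {s : ℕ}
    (hs : s < (w x₀[i]).length) (hps : (p : ℕ) = blockStart w x₀ i + s) :
    ∃ j : Fin x₀.length, x₀[i] = invLetter x₀[j] ∧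
      (τ p : ℕ) = blockStart w x₀ j + ((w x₀[j]).length - 1 - s) := by
  have hlen : V.length = (x₀.flatMap w).length := by rw [← hlab, List.length_map]
  have hpair := hp.pairing hnd hτ hπ hlen
  have h1 : s + d ≤ (w x₀[i]).length := by
    refine add_le_length_block w x₀ hs fun t h1 h2 => ?_
    obtain ⟨q, hq, -, hqs, -⟩ := hpair t h2
    rw [← hps, ← hq, ← hlen]
    exact ⟨q.2, fun j hj => hqs h1 ⟨j, hj⟩⟩
  -- Since `τ` reverses the run, the partner run begins at the image of its last position `e`.
  obtain ⟨e, he, hτe, -⟩ := hpair (d - 1) (by omega)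
  obtain ⟨j, t₀, ht₀, hj⟩ := exists_block w x₀ ((τ e).2.trans_eq hlen)
  have h2 : t₀ + d ≤ (w x₀[j]).length := by
    refine add_le_length_block w x₀ ht₀ fun t h1 h2 => ?_
    obtain ⟨q, hq, hτq, -, hqs⟩ := hpair (d - 1 - t) (by omega)
    have : blockStart w x₀ j + t₀ + t = τ q := by omega
    rw [this, ← hlen]
    exact ⟨(τ q).2, fun j hj => hqs (by omega) ⟨j, hj⟩⟩
  have hget : ∀ (i : Fin x₀.length) (t : ℕ) (q : Fin V.length), t < (w x₀[i]).length →
      (q : ℕ) = blockStart w x₀ i + t → (w x₀[i])[t]? = some (Prod.map lab id V[q]) := by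
    intro i t q ht hq
    rw [← getElem?_block w x₀ i ht, ← hlab, ← hq, List.getElem?_map, List.getElem?_eq_getElem q.2]
    rfl
  obtain ⟨h3, h4⟩ := hw.aligned h1 h2 fun r hr => by
    obtain ⟨q, hq, hτq, -⟩ := hpair r hr
    rw [hget i (s + r) q (by omega) (by omega),
      hget j (t₀ + (d - 1 - r)) (τ q) (by omega) (by omega), hτ]
    conv_lhs => rw [← invLetter_invLetter V[q]]
    rfl
  exact ⟨j, h3, by omega⟩

theorem card_isStart_le (V : List (C × Bool)) [DecidablePred (IsStart w x₀ V)] :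
    (Finset.univ.filter (IsStart w x₀ V)).card ≤ x₀.length := by
  classical
  rw [← Finset.card_map Fin.valEmbedding]
  refine (Finset.card_le_card (t := Finset.univ.image fun i : Fin x₀.length =>
    blockStart w x₀ i) ?_).trans (Finset.card_image_le.trans (by simp))
  intro p hp
  obtain ⟨q, hq, rfl⟩ := Finset.mem_map.1 hp
  obtain ⟨i, hi⟩ := (Finset.mem_filter.1 hq).2
  exact Finset.mem_image.2 ⟨i, Finset.mem_univ _, hi.symm⟩

/-- A fixed corner in the interior of a block would be an adjacent cancelling pair in a reduced
word. -/
theorem isStart_of_fixed (hred : ∀ u, FreeGroup.IsReduced (w u))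
    (hτ : ∀ p, V[τ p] = invLetter V[p])
    (hπ : π = τ.trans (finRotate V.length)) {lab : C → β}
    (hlab : V.map (Prod.map lab id) = x₀.flatMap w) {p : Fin V.length} (hp : π p = p) :
    IsStart w x₀ V p := by
  have hlen : V.length = (x₀.flatMap w).length := by rw [← hlab, List.length_map]
  obtain ⟨i, t, ht, hi⟩ := exists_block w x₀ (p.2.trans_eq hlen)
  rcases Nat.eq_zero_or_pos t with rfl | ht0
  · exact ⟨i, hi⟩
  exfalso
  have h1 : (p : ℕ) = if (τ p : ℕ) + 1 = V.length then 0 else (τ p : ℕ) + 1 := by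
    conv_lhs => rw [← hp, hπ, Equiv.trans_apply, val_finRotate]
  have h2 : (τ p : ℕ) = blockStart w x₀ i + (t - 1) := by
    split_ifs at h1 <;> omega
  have hget : ∀ (t : ℕ) (q : Fin V.length), t < (w x₀[i]).length →
      (q : ℕ) = blockStart w x₀ i + t → (w x₀[i])[t]? = some (Prod.map lab id V[q]) := by
    intro t q ht hq
    rw [← getElem?_block w x₀ i ht, ← hlab, ← hq, List.getElem?_map, List.getElem?_eq_getElem q.2]
    rfl
  have h3 := hget t p ht hi
  have h4 := hget (t - 1) (τ p) (by omega) h2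
  rw [hτ] at h4
  have h5 := List.isChain_iff_getElem.1 (hred x₀[i]) (t - 1) (by omega)
  simp only [show t - 1 + 1 = t by omega] at h5
  rw [List.getElem?_eq_getElem (by omega), Option.some_inj] at h3 h4
  rw [h3, h4] at h5
  simp [invLetter] at h5

/-- With `M` the length of `x₀`: `M` block starts, `M` corners sent to them by `π`, and `12k + 3M`
corners of valence at least 3. Fixed corners are block starts already. -/
theorem card_isCut_le (hred : ∀ u, FreeGroup.IsReduced (w u)) (hV : IsQuadratic V)
    (hk : IsCommProd k (FreeGroup.mk V)) (hτ : ∀ p, V[τ p] = invLetter V[p])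
    (hπ : π = τ.trans (finRotate V.length)) {lab : C → β}
    (hlab : V.map (Prod.map lab id) = x₀.flatMap w) [DecidablePred (IsCut w x₀ π)] :
    (Finset.univ.filter (IsCut w x₀ π)).card ≤ 12 * k + 5 * x₀.length := by
  classical
  have h1 := card_isStart_le (w := w) (x₀ := x₀) V
  have h2 : (Finset.univ.filter fun p => IsStart w x₀ V (π p)).card ≤ x₀.length := by
    refine le_trans (le_of_eq ?_) h1
    exact Finset.card_equiv π (by simp)
  have h3 : (Finset.univ.filter fun p => π p = p) ⊆ Finset.univ.filter (IsStart w x₀ V) := by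
    intro p hp
    exact Finset.mem_filter.2 ⟨Finset.mem_univ _,
      isStart_of_fixed hred hτ hπ hlab (Finset.mem_filter.1 hp).2⟩
  have h4 := card_corners_le hV hk hτ hπ
  have h5 : Finset.univ.filter (IsCut w x₀ π) ⊆ Finset.univ.filter (IsStart w x₀ V) ∪
      (Finset.univ.filter (fun p => IsStart w x₀ V (π p)) ∪
        Finset.univ.filter fun p => π p ≠ p ∧ π (π p) ≠ p) := by
    intro p hp
    have hp := (Finset.mem_filter.1 hp).2
    have : π p = p → IsStart w x₀ V p := fun h => isStart_of_fixed hred hτ hπ hlab h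
    simp only [Finset.mem_union, Finset.mem_filter, Finset.mem_univ, true_and]
    rcases hp with h | h | h | h <;> tauto
  have h6 := (Finset.card_le_card h5).trans ((Finset.card_union_le _ _).trans
    (Nat.add_le_add_left (Finset.card_union_le _ _) _))
  have h7 := (Finset.card_le_card h3).trans h1
  omega

/-- A bad position lies at distance between `1` and `d - 1` before a cut or before the end of the
word, whence the `+ 1`. -/
theorem card_not_isGood_le [DecidablePred (IsCut w x₀ π)] [DecidablePred (IsGood w x₀ d π)] :
    (Finset.univ.filter fun p => ¬ IsGood w x₀ d π p).card ≤
      ((Finset.univ.filter (IsCut w x₀ π)).card + 1) * (d - 1) := by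
  classical
  rw [← Finset.card_map Fin.valEmbedding]
  let cuts : Finset ℕ :=
    insert V.length ((Finset.univ.filter (IsCut w x₀ π)).map Fin.valEmbedding)
  have hc : cuts.card ≤ (Finset.univ.filter (IsCut w x₀ π)).card + 1 := by
    refine (Finset.card_insert_le _ _).trans ?_
    rw [Finset.card_map]
  have hsub : (Finset.univ.filter fun p => ¬ IsGood w x₀ d π p).map Fin.valEmbedding ⊆
      (cuts ×ˢ Finset.Ico 1 d).image fun z => z.1 - z.2 := by
    intro n hn
    obtain ⟨p, hp, rfl⟩ := Finset.mem_map.1 hn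
    have hp := (Finset.mem_filter.1 hp).2
    by_contra hn
    have hcut : ∀ t, 1 ≤ t → t < d → (p : ℕ) + t ∉ cuts := by
      intro t h1 h2 h3
      exact hn (Finset.mem_image.2 ⟨(p + t, t), Finset.mem_product.2
        ⟨h3, Finset.mem_Ico.2 ⟨h1, h2⟩⟩, by simp⟩)
    have hlt : ∀ t, t < d → (p : ℕ) + t < V.length := by
      intro t
      induction t with
      | zero => intro _; exact p.2
      | succ t ih =>
        intro h
        have h1 := ih (by omega)
        have h2 : (p : ℕ) + (t + 1) ≠ V.length := fun h2 => hcut (t + 1) (by omega) h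
          (Finset.mem_insert.2 (.inl h2))
        omega
    refine hp fun t h1 h2 => ⟨⟨p + t, hlt t h2⟩, rfl, fun h3 => hcut t h1 h2 ?_⟩
    exact Finset.mem_insert.2 (.inr (Finset.mem_map.2 ⟨_, Finset.mem_filter.2
      ⟨Finset.mem_univ _, h3⟩, rfl⟩))
  refine (Finset.card_le_card hsub).trans (Finset.card_image_le.trans ?_)
  rw [Finset.card_product, Nat.card_Ico]
  exact Nat.mul_le_mul_right _ hc

/-- The place in the word of `u` corresponding to the place `t` in the word of the positive letter
with the same name. -/
def orient (w : B × Bool → List (β × Bool)) (u : B × Bool) (t : ℕ) : ℕ :=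
  if u.2 then t else (w u).length - 1 - t

theorem orient_lt {u : B × Bool} {t : ℕ} (ht : t < (w u).length) : orient w u t < (w u).length := by
  unfold orient; split_ifs <;> omega

/-- Otherwise each of the `m` places yields a bad position in some block of `b^{±1}`, and different
places yield different positions. -/
theorem exists_good_place {m : ℕ} (hm : ∀ u, m ≤ (w u).length) [DecidablePred (IsGood w x₀ d π)]
    (hbad : (Finset.univ.filter fun p => ¬ IsGood w x₀ d π p).card < m) (b : B) :
    ∃ t < m, ∀ (i : Fin x₀.length) (p : Fin V.length), x₀[i].1 = b →
      (p : ℕ) = blockStart w x₀ i + orient w x₀[i] t → IsGood w x₀ d π p := by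
  by_contra! hcon
  choose i p hi hp hg using fun t : Fin m => hcon t t.2
  have hinj : Function.Injective p := by
    intro s t hst
    have h1 : blockStart w x₀ (i s) + orient w x₀[i s] s =
        blockStart w x₀ (i t) + orient w x₀[i t] t := by rw [← hp, ← hp, hst]
    obtain ⟨h2, h3⟩ := block_unique w x₀ (orient_lt (s.2.trans_le (hm _)))
      (orient_lt (t.2.trans_le (hm _))) h1
    have h4 : orient w x₀[i t] s = orient w x₀[i t] t := by
      rw [← h3]; simp only [h2]
    have h5 := s.2.trans_le (hm x₀[i t])
    have h6 := t.2.trans_le (hm x₀[i t])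
    apply Fin.ext
    unfold orient at h4
    split_ifs at h4 <;> omega
  have := Finset.card_le_card_of_injOn (s := Finset.univ)
    (t := Finset.univ.filter fun p => ¬ IsGood w x₀ d π p) p
    (fun t _ => by simpa using hg t) hinj.injOn
  rw [Finset.card_univ, Fintype.card_fin] at this
  omega

theorem isCommProd_of_hasLift (hw : IsRigid w d) (hd : 1 ≤ d) {m : ℕ} (hm : ∀ u, m ≤ (w u).length)
    (hmd : (12 * k + 5 * x₀.length + 1) * (d - 1) < m) (hL : HasLift k (x₀.flatMap w)) :
    IsCommProd k (FreeGroup.mk x₀) := by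
  classical
  obtain ⟨V, hV, hk, hlab⟩ := hL
  have hlen : V.length = (x₀.flatMap w).length := by rw [← hlab, List.length_map]
  obtain ⟨τ, hτ⟩ := hV.exists_perm
  obtain ⟨π, hπ⟩ : ∃ π, π = τ.trans (finRotate V.length) := ⟨_, rfl⟩
  have hbad : (Finset.univ.filter fun p => ¬ IsGood w x₀ d π p).card < m :=
    (card_not_isGood_le.trans (Nat.mul_le_mul_right _ (Nat.add_le_add_right
      (card_isCut_le hw.isReduced hV hk hτ hπ hlab) 1))).trans_lt hmd
  choose t htm ht using exists_good_place hm hbad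
  have hlt : ∀ i : Fin x₀.length, orient w x₀[i] (t x₀[i].1) < (w x₀[i]).length := fun i =>
    orient_lt ((htm _).trans_le (hm _))
  let pos : Fin x₀.length → Fin V.length := fun i =>
    ⟨blockStart w x₀ i + orient w x₀[i] (t x₀[i].1), hlen ▸ block_lt_length w x₀ i (hlt i)⟩
  refine isCommProd_of_positions hV.nodup hk hτ (pos := pos)
    (fun i j hij => block_lt_block w x₀ hij (hlt i)) fun i => ?_
  obtain ⟨j, hj, hτj⟩ := (ht _ i (pos i) rfl rfl).exists_partner hw hd hV.nodup hτ hπ hlab (hlt i)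
    rfl
  refine ⟨j, Fin.ext ?_, hj⟩
  rw [hτj]
  simp only [pos]
  congr 1
  have h1 : (w x₀[i]).length = (w x₀[j]).length := by
    rw [hj, hw.map_invLetter, FreeGroup.invRev_length]
  have h2 : x₀[i].1 = x₀[j].1 := by rw [hj]; rfl
  have h3 : x₀[i].2 = !x₀[j].2 := by rw [hj]; rfl
  have h4 := (htm x₀[j].1).trans_le (hm x₀[j])
  -- The mirror image of the chosen place for a letter is the chosen place for its inverse, so the
  -- chosen positions are closed under `τ`.
  have key : ∀ (b : Bool) (l t : ℕ), t < l →
      l - 1 - (if (!b) = true then t else l - 1 - t) = if b = true then t else l - 1 - t := by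
    intro b l t ht
    cases b
    · simp only [Bool.not_false, if_true, Bool.false_eq_true, if_false]
    · simp only [Bool.not_true, if_true, Bool.false_eq_true, if_false]
      omega
  unfold orient
  rw [h1, h2, h3]
  exact key _ _ _ h4

end

/-! ### Application to α-maps -/

theorem letterWord_invLetter {B₁ B₂ : Type*} [DecidableEq B₂] (φ : FreeGroup B₁ →* FreeGroup B₂)
    (u : B₁ × Bool) : letterWord φ (invLetter u) = FreeGroup.invRev (letterWord φ u) := by
  rw [letterWord, letterWord, mk_invLetter, map_inv, FreeGroup.toWord_inv]

theorem mk_flatMap_letterWord {B₁ B₂ : Type*} [DecidableEq B₂]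
    (φ : FreeGroup B₁ →* FreeGroup B₂) (x₀ : List (B₁ × Bool)) :
    FreeGroup.mk (x₀.flatMap (letterWord φ)) = φ (FreeGroup.mk x₀) := by
  induction x₀ with
  | nil => simp [← FreeGroup.one_eq_mk]
  | cons a x₀ ih =>
    rw [List.flatMap_cons, ← FreeGroup.mul_mk, ih, ← List.singleton_append (l := x₀),
      ← FreeGroup.mul_mk (L₁ := [a]), map_mul, letterWord, FreeGroup.mk_toWord]

theorem minLength_le_length {B₁ B₂ : Type*} [DecidableEq B₂] (φ : FreeGroup B₁ →* FreeGroup B₂)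
    (u : B₁ × Bool) : minLength φ ≤ (letterWord φ u).length := by
  have h : ∀ b : B₁, minLength φ ≤ (letterWord φ (b, true)).length := fun b =>
    ciInf_le (OrderBot.bddBelow _) b
  rcases u with ⟨b, _ | _⟩
  · have := letterWord_invLetter φ (b, true)
    rw [invLetter, Bool.not_true] at this
    rw [this, FreeGroup.invRev_length]
    exact h b
  · exact h b

theorem IsAlphaMap.minLength_pos {B₁ B₂ : Type*} [DecidableEq B₂] [Nonempty B₁] {α : ℝ}
    {φ : FreeGroup B₁ →* FreeGroup B₂} (h : IsAlphaMap α φ) : 0 < minLength φ := by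
  by_contra h0
  have b := Classical.arbitrary B₁
  -- If the minimal length were 0, the empty word would count as a long subword shared by `b` and
  -- `b⁻¹`.
  have := h.eq_of_shared (b, true) (b, false) [] (by simp [Nat.eq_zero_of_not_pos h0])
    List.nil_infix List.nil_infix
  simp at this

theorem IsAlphaMap.isRigid {B₁ B₂ : Type*} [DecidableEq B₂] {α : ℝ}
    {φ : FreeGroup B₁ →* FreeGroup B₂} (h : IsAlphaMap α φ) :
    IsRigid (letterWord φ) ⌈α * minLength φ⌉₊ where
  map_invLetter := letterWord_invLetter φ
  isReduced _ := FreeGroup.isReduced_toWord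
  eq_of_shared u v l hl := h.eq_of_shared u v l (Nat.ceil_le.1 hl)
  occurs_once u l p q p' q' hl h1 h2 := by
    rcases u with ⟨b, _ | _⟩
    · have h3 := letterWord_invLetter φ (b, false)
      rw [invLetter, Bool.not_false] at h3
      have hdecomp : ∀ p q, letterWord φ (b, false) = p ++ l ++ q → letterWord φ (b, true) =
          FreeGroup.invRev q ++ FreeGroup.invRev l ++ FreeGroup.invRev p := by
        intro p q h4
        rw [h3, h4]
        simp [FreeGroup.invRev]
      have := (h.occurs_once b _ _ _ _ _ (by rw [FreeGroup.invRev_length]; exact Nat.ceil_le.1 hl)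
        (hdecomp p q h1) (hdecomp p' q' h2)).2
      exact FreeGroup.invRev_injective this
    · exact (h.occurs_once b l p q p' q' (Nat.ceil_le.1 hl) h1 h2).1

theorem isCommProd_conj_iff {G : Type*} [Group G] {k : ℕ} {c y : G} :
    IsCommProd k (c * y * c⁻¹) ↔ IsCommProd k y := by
  refine ⟨fun h => ?_, fun h => h.map (MulAut.conj c).toMonoidHom⟩
  simpa [mul_assoc] using h.map (MulAut.conj c⁻¹).toMonoidHom

theorem isCommProd_one {G : Type*} [Group G] (k : ℕ) : IsCommProd k (1 : G) := by
  refine ⟨fun _ => 1, fun _ => 1, List.prod_eq_one fun y hy => ?_⟩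
  obtain ⟨i, rfl⟩ := (List.mem_ofFn' _ _).1 hy
  simp

theorem IsAlphaMap.isCommProd_mk {B₁ B₂ : Type*} [DecidableEq B₂] [Nonempty B₁] {α : ℝ}
    (hα : 0 < α) {φ : FreeGroup B₁ →* FreeGroup B₂} (h : IsAlphaMap α φ) {x₀ : List (B₁ × Bool)}
    {k : ℕ} (hαk : α * (12 * k + 5 * x₀.length + 1) < 1)
    (hk : IsCommProd k (φ (FreeGroup.mk x₀))) : IsCommProd k (FreeGroup.mk x₀) := by
  have hpos : (0 : ℝ) < minLength φ := Nat.cast_pos.2 h.minLength_pos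
  have hαm : 0 < α * minLength φ := mul_pos hα hpos
  have hd : 1 ≤ ⌈α * minLength φ⌉₊ := Nat.one_le_ceil_iff.2 hαm
  refine isCommProd_of_hasLift h.isRigid hd (minLength_le_length φ) ?_ ?_
  · have h1 : ((⌈α * minLength φ⌉₊ - 1 : ℕ) : ℝ) < α * minLength φ := by
      rw [Nat.cast_sub hd, Nat.cast_one, sub_lt_iff_lt_add]
      exact Nat.ceil_lt_add_one hαm.le
    have h2 : (0 : ℝ) < 12 * k + 5 * x₀.length + 1 := by positivity
    have h3 : ((12 * k + 5 * x₀.length + 1 : ℕ) : ℝ) * (⌈α * minLength φ⌉₊ - 1 : ℕ) <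
        minLength φ := by
      push_cast
      calc _ < (12 * k + 5 * x₀.length + 1 : ℝ) * (α * minLength φ) :=
            mul_lt_mul_of_pos_left h1 h2
        _ = α * (12 * k + 5 * x₀.length + 1) * minLength φ := by ring
        _ < 1 * minLength φ := mul_lt_mul_of_pos_right hαk hpos
        _ = minLength φ := one_mul _
    exact_mod_cast h3
  · obtain ⟨L, hL, hlift⟩ := exists_hasLift_of_isCommProd hk
    rwa [HasLift.congr (hL.trans (mk_flatMap_letterWord φ x₀).symm)] at hlift

theorem hasGenus_iff {F : Type*} [Group F] {x : F} {g : ℕ} :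
    HasGenus x g ↔ IsCommProd g x ∧ ∀ k, IsCommProd k x → g ≤ k := by
  simp only [HasGenus, IsLeast, lowerBounds, Set.mem_ofPred_eq, ← isCommProd_iff_exists_isGenusRep]

theorem IsAlphaMap.hasGenus {B₁ B₂ : Type*} [DecidableEq B₁] [DecidableEq B₂] [Nonempty B₁]
    {x : FreeGroup B₁} {g : ℕ} (hx : HasGenus x g) {α : ℝ} (hα : 0 < α)
    (hαx : α * (4 * (cyclicLength x : ℝ) * (48 * (g : ℝ) - 24 + (cyclicLength x : ℝ))) < 1)
    {φ : FreeGroup B₁ →* FreeGroup B₂} (h : IsAlphaMap α φ) : HasGenus (φ x) g := by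
  rw [hasGenus_iff] at hx ⊢
  refine ⟨hx.1.map φ, fun k hk => ?_⟩
  by_contra! hkg
  refine hkg.not_ge (hx.2 k ?_)
  obtain ⟨x₀, hx₀⟩ : ∃ x₀, x₀ = FreeGroup.reduceCyclically x.toWord := ⟨_, rfl⟩
  have hM : cyclicLength x = x₀.length := by rw [hx₀]; rfl
  obtain ⟨c, hc⟩ : ∃ c, x = c * FreeGroup.mk x₀ * c⁻¹ := by
    refine ⟨FreeGroup.mk (FreeGroup.reduceCyclically.conjugator x.toWord), ?_⟩
    rw [FreeGroup.inv_mk, FreeGroup.mul_mk, FreeGroup.mul_mk, hx₀,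
      FreeGroup.reduceCyclically.conj_conjugator_reduceCyclically, FreeGroup.mk_toWord]
  rw [hM] at hαx
  rw [hc, isCommProd_conj_iff]
  rw [hc, map_mul, map_mul, map_inv, isCommProd_conj_iff] at hk
  rcases Nat.eq_zero_or_pos x₀.length with h0 | h0
  · rw [List.length_eq_zero_iff.1 h0, ← FreeGroup.one_eq_mk]
    exact isCommProd_one k
  refine h.isCommProd_mk hα (lt_of_le_of_lt (mul_le_mul_of_nonneg_left ?_ hα.le) hαx) hk
  have h1 : (1 : ℝ) ≤ x₀.length := by exact_mod_cast h0
  have h2 : (k : ℝ) + 1 ≤ g := by exact_mod_cast hkg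
  have h3 : (0 : ℝ) ≤ k := Nat.cast_nonneg k
  -- The argument needs only `12k + 5M + 1`; the larger stated constant dominates it because `k + 1
  -- ≤ g` and `M ≥ 1`.
  calc (12 * k + 5 * x₀.length + 1 : ℝ) ≤ 4 * x₀.length * (48 * k + 24 + x₀.length) := by
        nlinarith [mul_nonneg h3 (sub_nonneg.2 h1)]
    _ ≤ 4 * x₀.length * (48 * g - 24 + x₀.length) := by
        gcongr
        linarith

end AlphaMap

theorem mainTheorem9 {B₁ : Type u} [DecidableEq B₁] [Finite B₁] [Nontrivial B₁]
    (x : FreeGroup B₁) (g : ℕ) (hx : AlphaMap.HasGenus x g) :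
    (∃ α : ℝ, 0 < α ∧
      ∀ (B₂ : Type v) [DecidableEq B₂] [Finite B₂] [Nontrivial B₂]
        (φ : FreeGroup B₁ →* FreeGroup B₂),
        AlphaMap.IsAlphaMap α φ → AlphaMap.HasGenus (φ x) g) ∧
    (∀ α : ℝ, 0 < α →
      α * (4 * (AlphaMap.cyclicLength x : ℝ) *
        (48 * (g : ℝ) - 24 + (AlphaMap.cyclicLength x : ℝ))) < 1 →
      ∀ (B₂ : Type v) [DecidableEq B₂] [Finite B₂] [Nontrivial B₂]
        (φ : FreeGroup B₁ →* FreeGroup B₂),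
        AlphaMap.IsAlphaMap α φ → AlphaMap.HasGenus (φ x) g) := by
  refine ⟨?_, fun α hα hαx B₂ _ _ _ φ h => h.hasGenus hx hα hαx⟩
  obtain ⟨Q, hQ⟩ : ∃ Q : ℝ, Q = 4 * (AlphaMap.cyclicLength x : ℝ) *
    (48 * (g : ℝ) - 24 + (AlphaMap.cyclicLength x : ℝ)) := ⟨_, rfl⟩
  have h1 : 0 < |Q| + 1 := by positivity
  -- The absolute value makes this positive without determining the sign of `Q`.
  refine ⟨(|Q| + 1)⁻¹, inv_pos.2 h1, fun B₂ _ _ _ φ h => h.hasGenus hx (inv_pos.2 h1) ?_⟩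
  rw [← hQ, inv_mul_lt_iff₀ h1, mul_one]
  linarith [le_abs_self Q]
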